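/- Let $K\ge 1$ be an integer and let $v\colon\mathbb{Z}\to\mathbb{R}$ be $K$-periodic, i.e. $v(n+K)=v(n)$ for all $n\in\mathbb{Z}$. For $p\in[1,\infty]$ let $H$ be the bounded operator on the complex sequence space $\ell^p(\mathbb{Z})$ given by $(Hx)_n=x_{n+1}+x_{n-1}+v(n)x_n$, and let $H_+$ be its compression to $\ell^p(\mathbb{Z}_+)$, $\mathbb{Z}_+=\{0,1,2,\dots\}$, given by $(H_+x)_n=x_{n+1}+x_{n-1}+v(n)x_n$ for $n\ge 0$, where $x_{-1}:=0$. "Invertible" means having a bounded inverse. Put $$T(n)=\begin{pmatrix}-v(n)&-1\\1&0\end{pmatrix},\qquad M=T(K-1)\cdots T(1)\,T(0)$$ (the monodromy matrix at energy $0$). For every $p\in[1,\infty]$, the operator $H$ is invertible on $\ell^p(\mathbb{Z})$ if and only if $|\operatorname{tr}M|>2$. If this is the case, then $M$ has two real eigenvalues $\lambda_1,\lambda_2$ with $|\lambda_2|<1<|\lambda_1|$, and the following are equivalent: 1. $H_+$ is not injective on $\ell^\infty(\mathbb{Z}_+)$; 2. $H_+$ is not invertible on $\ell^p(\mathbb{Z}_+)$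 for any $p\in[1,\infty]$; 3. $H_+$ is not invertible on $\ell^p(\mathbb{Z}_+)$ for some $p\in[1,\infty]$; 4. $(1,0)^T$ is an eigenvector of $M$ for the eigenvalue $\lambda_2$ of modulus less than $1$; 5. $M_{2,1}=0$ and $|M_{1,1}|<1$. -/

import Mathlib

open scoped ENNReal lp

noncomputable section

namespace PeriodicSchrodinger

theorem memlp_comp {α β : Type*} {p : ℝ≥0∞} {f : α → β} (hf : Function.Injective f)
    {x : β → ℂ} (hx : Memℓp x p) : Memℓp (fun a => x (f a)) p := by
  obtain (rfl | rfl | hp) := p.trichotomy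
  · rw [memℓp_zero_iff] at hx ⊢
    exact hx.preimage hf.injOn
  · rw [memℓp_infty_iff] at hx ⊢
    refine hx.mono ?_
    rintro _ ⟨a, rfl⟩
    exact ⟨f a, rfl⟩
  · rw [memℓp_gen_iff hp] at hx ⊢
    exact hx.comp_injective hf

theorem norm_comp_le {α β : Type*} {p : ℝ≥0∞} [Fact (1 ≤ p)] {f : α → β}
    (hf : Function.Injective f) (x : ℓ^p(β, ℂ)) :
    ‖(⟨fun a => x (f a), memlp_comp hf (lp.memℓp x)⟩ : ℓ^p(α, ℂ))‖ ≤ ‖x‖ := by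
  have hp0 : p ≠ 0 := (zero_lt_one.trans_le (Fact.out : 1 ≤ p)).ne'
  obtain (rfl | rfl | hp) := p.trichotomy
  · exact (hp0 rfl).elim
  · exact lp.norm_le_of_forall_le (norm_nonneg _) fun a => lp.norm_apply_le_norm hp0 x (f a)
  · refine lp.norm_le_of_forall_sum_le hp (norm_nonneg _) fun s => ?_
    have h := lp.sum_rpow_le_norm_rpow hp x (s.map ⟨f, hf⟩)
    simpa using h

/-- Pull-back `x ↦ x ∘ f` along an injective map `f`, as a bounded operator. It provides the shifts
of `ℓ^p(ℤ)` and the restriction `ℓ^p(ℤ) → ℓ^p(ℤ₊)`. -/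
def pullback (p : ℝ≥0∞) [Fact (1 ≤ p)] {α β : Type*} (f : α → β) (hf : Function.Injective f) :
    ℓ^p(β, ℂ) →L[ℂ] ℓ^p(α, ℂ) :=
  LinearMap.mkContinuous
    { toFun := fun x => ⟨fun a => x (f a), memlp_comp hf (lp.memℓp x)⟩
      map_add' := fun _ _ => rfl
      map_smul' := fun _ _ => rfl } 1
    (fun x => by rw [one_mul]; exact norm_comp_le hf x)

@[simp]
theorem pullback_apply (p : ℝ≥0∞) [Fact (1 ≤ p)] {α β : Type*} (f : α → β)
    (hf : Function.Injective f) (x : ℓ^p(β, ℂ)) (a : α) : pullback p f hf x a = x (f a) := rfl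

/-- Extension by zero of a sequence on `ℤ₊ = {0, 1, 2, …}` to a sequence on `ℤ`. -/
def extendZero (x : ℕ → ℂ) (n : ℤ) : ℂ := if 0 ≤ n then x n.toNat else 0

theorem memlp_extendZero {p : ℝ≥0∞} {x : ℕ → ℂ} (hx : Memℓp x p) : Memℓp (extendZero x) p := by
  have hinj : Function.Injective (fun n : ℕ => (n : ℤ)) := Nat.cast_injective
  have hout : ∀ n : ℤ, n ∉ Set.range (fun n : ℕ => (n : ℤ)) → extendZero x n = 0 := by
    intro n hn
    refine if_neg fun h => hn ⟨n.toNat, Int.toNat_of_nonneg h⟩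
  obtain (rfl | rfl | hp) := p.trichotomy
  · rw [memℓp_zero_iff] at hx ⊢
    refine (hx.image (fun n : ℕ => (n : ℤ))).subset fun n hn => ?_
    by_cases h : 0 ≤ n
    · refine ⟨n.toNat, ?_, Int.toNat_of_nonneg h⟩
      simpa [extendZero, h] using hn
    · exact (hn (if_neg h)).elim
  · rw [memℓp_infty_iff] at hx ⊢
    obtain ⟨C, hC⟩ := hx
    refine ⟨max C 0, ?_⟩
    rintro _ ⟨n, rfl⟩
    by_cases h : 0 ≤ n
    · simpa [extendZero, h] using Or.inl (hC ⟨n.toNat, rfl⟩)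
    · simp [extendZero, h]
  · rw [memℓp_gen_iff hp] at hx ⊢
    refine (hinj.summable_iff fun n hn => ?_).1 ?_
    · rw [hout n hn, norm_zero, Real.zero_rpow hp.ne']
    · simpa [Function.comp_def, extendZero] using hx

theorem norm_extendZero_le {p : ℝ≥0∞} [Fact (1 ≤ p)] (x : ℓ^p(ℕ, ℂ)) :
    ‖(⟨extendZero x, memlp_extendZero (lp.memℓp x)⟩ : ℓ^p(ℤ, ℂ))‖ ≤ ‖x‖ := by
  have hp0 : p ≠ 0 := (zero_lt_one.trans_le (Fact.out : 1 ≤ p)).ne'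
  obtain (rfl | rfl | hp) := p.trichotomy
  · exact (hp0 rfl).elim
  · refine lp.norm_le_of_forall_le (norm_nonneg _) fun n => ?_
    by_cases h : 0 ≤ n
    · simpa [extendZero, h] using lp.norm_apply_le_norm hp0 x n.toNat
    · simp [extendZero, h]
  · have hinj : Function.Injective (fun n : ℕ => (n : ℤ)) := Nat.cast_injective
    refine lp.norm_le_of_tsum_le hp (norm_nonneg _) ?_
    rw [lp.norm_rpow_eq_tsum hp x, ← hinj.tsum_eq]
    · simp [extendZero]
    · intro n hn
      by_contra h
      refine hn ?_
      have : extendZero x n = 0 := if_neg fun h' => h ⟨n.toNat, Int.toNat_of_nonneg h'⟩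
      change ‖extendZero x n‖ ^ p.toReal = 0
      rw [this, norm_zero, Real.zero_rpow hp.ne']

/-- The embedding `ℓ^p(ℤ₊) → ℓ^p(ℤ)` by extension by zero. -/
def embed (p : ℝ≥0∞) [Fact (1 ≤ p)] : ℓ^p(ℕ, ℂ) →L[ℂ] ℓ^p(ℤ, ℂ) :=
  LinearMap.mkContinuous
    { toFun := fun x => ⟨extendZero x, memlp_extendZero (lp.memℓp x)⟩
      map_add' := fun x y => by
        apply lp.ext
        funext n
        change extendZero (fun k => x k + y k) n = extendZero x n + extendZero y n
        by_cases h : 0 ≤ n <;> simp [extendZero, h]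
      map_smul' := fun c x => by
        apply lp.ext
        funext n
        by_cases h : 0 ≤ n <;> simp [extendZero, h] } 1
    (fun x => by rw [one_mul]; exact norm_extendZero_le x)

@[simp]
theorem embed_apply (p : ℝ≥0∞) [Fact (1 ≤ p)] (x : ℓ^p(ℕ, ℂ)) (n : ℤ) :
    embed p x n = extendZero x n := rfl

theorem memlp_mul {p : ℝ≥0∞} {v : ℤ → ℝ} (hv : ∃ C, ∀ n, |v n| ≤ C) {x : ℤ → ℂ}
    (hx : Memℓp x p) : Memℓp (fun n => (v n : ℂ) * x n) p := by
  obtain ⟨C, hC⟩ := hv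
  refine (hx.norm.const_mul C).mono fun n => ?_
  rw [norm_mul, Complex.norm_real, Real.norm_eq_abs]
  exact mul_le_mul_of_nonneg_right (hC n) (norm_nonneg _)

/-- Multiplication by a bounded real sequence `v`, as a bounded operator. -/
def mulOp (p : ℝ≥0∞) [Fact (1 ≤ p)] (v : ℤ → ℝ) (hv : ∃ C, ∀ n, |v n| ≤ C) :
    ℓ^p(ℤ, ℂ) →L[ℂ] ℓ^p(ℤ, ℂ) :=
  LinearMap.mkContinuousOfExistsBound
    { toFun := fun x => ⟨fun n => (v n : ℂ) * x n, memlp_mul hv (lp.memℓp x)⟩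
      map_add' := fun x y => by
        apply lp.ext
        funext n
        exact mul_add (v n : ℂ) (x n) (y n)
      map_smul' := fun c x => by
        apply lp.ext
        funext n
        simp [mul_left_comm] }
    (by
      obtain ⟨C, hC⟩ := hv
      have hp0 : p ≠ 0 := (zero_lt_one.trans_le (Fact.out : 1 ≤ p)).ne'
      have hC0 : 0 ≤ C := (abs_nonneg _).trans (hC 0)
      refine ⟨C, fun x => ?_⟩
      have h : ‖(C : ℂ) • x‖ = C * ‖x‖ := by
        rw [norm_smul, Complex.norm_real, Real.norm_eq_abs, abs_of_nonneg hC0]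
      rw [← h]
      refine lp.norm_mono hp0 fun n => ?_
      simp only [LinearMap.coe_mk, AddHom.coe_mk, lp.coeFn_smul, Pi.smul_apply, smul_eq_mul,
        norm_mul, Complex.norm_real, Real.norm_eq_abs, abs_of_nonneg hC0]
      exact mul_le_mul_of_nonneg_right (hC n) (norm_nonneg _))

@[simp]
theorem mulOp_apply (p : ℝ≥0∞) [Fact (1 ≤ p)] (v : ℤ → ℝ) (hv : ∃ C, ∀ n, |v n| ≤ C)
    (x : ℓ^p(ℤ, ℂ)) (n : ℤ) : mulOp p v hv x n = (v n : ℂ) * x n := rfl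

/-- The discrete Schrödinger operator `(H x)_n = x_{n+1} + x_{n-1} + v(n) x_n` on `ℓ^p(ℤ)` with
bounded real potential `v`. -/
def schrodinger (p : ℝ≥0∞) [Fact (1 ≤ p)] (v : ℤ → ℝ) (hv : ∃ C, ∀ n, |v n| ≤ C) :
    ℓ^p(ℤ, ℂ) →L[ℂ] ℓ^p(ℤ, ℂ) :=
  pullback p (fun n => n + 1) (add_left_injective (1 : ℤ))
    + pullback p (fun n => n - 1) (sub_left_injective (b := (1 : ℤ)))
    + mulOp p v hv

theorem schrodinger_apply (p : ℝ≥0∞) [Fact (1 ≤ p)] (v : ℤ → ℝ) (hv : ∃ C, ∀ n, |v n| ≤ C)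
    (x : ℓ^p(ℤ, ℂ)) (n : ℤ) :
    schrodinger p v hv x n = x (n + 1) + x (n - 1) + (v n : ℂ) * x n := rfl

/-- The one-sided compression `H₊` of `H` to `ℓ^p(ℤ₊)`: extend by zero, apply `H`, restrict. -/
def schrodingerPlus (p : ℝ≥0∞) [Fact (1 ≤ p)] (v : ℤ → ℝ) (hv : ∃ C, ∀ n, |v n| ≤ C) :
    ℓ^p(ℕ, ℂ) →L[ℂ] ℓ^p(ℕ, ℂ) :=
  pullback p (fun n : ℕ => (n : ℤ)) Nat.cast_injective ∘L schrodinger p v hv ∘L embed p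

/-- The first row of `H₊`: the Dirichlet condition `x_{-1} = 0`. -/
theorem schrodingerPlus_apply_zero (p : ℝ≥0∞) [Fact (1 ≤ p)] (v : ℤ → ℝ)
    (hv : ∃ C, ∀ n, |v n| ≤ C) (x : ℓ^p(ℕ, ℂ)) :
    schrodingerPlus p v hv x 0 = x 1 + (v 0 : ℂ) * x 0 := by
  simp [schrodingerPlus, schrodinger_apply, extendZero]

/-- The other rows of `H₊`. -/
theorem schrodingerPlus_apply_succ (p : ℝ≥0∞) [Fact (1 ≤ p)] (v : ℤ → ℝ)
    (hv : ∃ C, ∀ n, |v n| ≤ C) (x : ℓ^p(ℕ, ℂ)) (n : ℕ) :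
    schrodingerPlus p v hv x (n + 1) = x (n + 2) + x n + (v (n + 1) : ℂ) * x (n + 1) := by
  have h1 : (0 : ℤ) ≤ (n : ℤ) + 1 + 1 := by positivity
  have h2 : (0 : ℤ) ≤ (n : ℤ) + 1 := by positivity
  have h3 : ((n : ℤ) + 1 + 1).toNat = n + 2 := by omega
  simp [schrodingerPlus, schrodinger_apply, extendZero, h1, h2, h3]

theorem bounded_of_periodic {v : ℤ → ℝ} {K : ℕ} (hK : 0 < K)
    (hv : Function.Periodic v (K : ℤ)) : ∃ C, ∀ n, |v n| ≤ C := by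
  have hK' : (0 : ℤ) < K := by exact_mod_cast hK
  refine ⟨∑ i ∈ Finset.range K, |v i|, fun n => ?_⟩
  have h0 : 0 ≤ n % (K : ℤ) := Int.emod_nonneg _ hK'.ne'
  have h1 : n % (K : ℤ) < K := Int.emod_lt_of_pos _ hK'
  have h2 : v n = v ((n % (K : ℤ)).toNat : ℤ) := by
    rw [Int.toNat_of_nonneg h0]
    conv_lhs => rw [← Int.emod_add_mul_ediv n K, mul_comm]
    exact hv.int_mul (n / K) _
  rw [h2]
  exact Finset.single_le_sum (f := fun i : ℕ => |v i|) (fun _ _ => abs_nonneg _)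
    (Finset.mem_range.2 (by omega))

/-- The transfer matrix `T(n, E)`. -/
def transferMatrix (v : ℤ → ℝ) (E : ℝ) (n : ℤ) : Matrix (Fin 2) (Fin 2) ℝ :=
  !![E - v n, -1; 1, 0]

/-- The product `T(K-1, E) ⋯ T(1, E) T(0, E)`; for a `K`-periodic potential `v` this is the
monodromy matrix `M(E)`. -/
def monodromy (v : ℤ → ℝ) (E : ℝ) : ℕ → Matrix (Fin 2) (Fin 2) ℝ
  | 0 => 1
  | k + 1 => transferMatrix v E k * monodromy v E k

end PeriodicSchrodinger

end

open PeriodicSchrodinger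

namespace PeriodicSchrodinger

/-! ### Operators with summably dominated kernels -/

/-! Everything is read off from the solutions of `Hφ = 0`. As `det M = 1`, an eigenvector of `M`
extends to a Floquet solution multiplied by its eigenvalue over each period (`exists_floquet`). If
`|tr M| ≤ 2`, some complex eigenvalue is unimodular, so there is a bounded solution; damping it
slowly yields approximate null vectors in every `ℓ^p` at once, and `H` has no bounded inverse. If
`|tr M| > 2`, there are real solutions `φ`, `ψ` decaying exponentially to the left and to the right,
with nonzero Wronskian (`exists_dichotomy`). Their Green kernel decays exponentially off the
diagonal, hence is a norm-convergent sum of weighted shifts on every `ℓ^p` and inverts `H`. On the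
half line, `φ` is replaced by a combination `χ` of `φ` and `ψ` with `χ (-1) = 0`. This inverts `H₊`
as long as `ψ (-1) ≠ 0`, that is, unless `(1, 0)` is an eigenvector for `l₂`. In the exceptional
case the decaying solution itself lies in the kernel of `H₊` for every `p`, which is why the choice
of `p` is immaterial. -/

theorem exponent_ne_zero (p : ℝ≥0∞) [h : Fact (1 ≤ p)] : p ≠ 0 :=
  (zero_lt_one.trans_le h.out).ne'

theorem norm_pullback_le (p : ℝ≥0∞) [Fact (1 ≤ p)] {α β : Type*} (f : α → β)
    (hf : Function.Injective f) : ‖pullback p f hf‖ ≤ 1 :=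
  LinearMap.mkContinuous_norm_le _ zero_le_one _

theorem norm_mulOp_le (p : ℝ≥0∞) [Fact (1 ≤ p)] {v : ℤ → ℝ} {C : ℝ} (hC : ∀ n, |v n| ≤ C) :
    ‖mulOp p v ⟨C, hC⟩‖ ≤ C := by
  have hC0 : 0 ≤ C := (abs_nonneg _).trans (hC 0)
  refine ContinuousLinearMap.opNorm_le_bound _ hC0 fun x => ?_
  have h : ‖(C : ℂ) • x‖ = C * ‖x‖ := by
    rw [norm_smul, Complex.norm_real, Real.norm_eq_abs, abs_of_nonneg hC0]
  rw [← h]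
  refine lp.norm_mono (exponent_ne_zero p) fun n => ?_
  simp only [mulOp_apply, lp.coeFn_smul, Pi.smul_apply, smul_eq_mul,
    norm_mul, Complex.norm_real, Real.norm_eq_abs, abs_of_nonneg hC0]
  exact mul_le_mul_of_nonneg_right (hC n) (norm_nonneg _)

/-- A kernel dominated by a summable function of `m - n` defines a bounded operator on every
`ℓ^p(ℤ)`. -/
theorem exists_kernelOp (p : ℝ≥0∞) [Fact (1 ≤ p)] {g : ℤ → ℤ → ℝ} {b : ℤ → ℝ} (hb : Summable b)
    (hg : ∀ k n, |g n (n + k)| ≤ b k) :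
    ∃ G : ℓ^p(ℤ, ℂ) →L[ℂ] ℓ^p(ℤ, ℂ), ∀ x n, HasSum (fun m => (g n m : ℂ) * x m) (G x n) := by
  -- `A k` is the `k`-th diagonal of the kernel: a shift followed by multiplication by a sequence
  -- bounded by `b k`. The diagonals sum in operator norm.
  let A : ℤ → ℓ^p(ℤ, ℂ) →L[ℂ] ℓ^p(ℤ, ℂ) := fun k =>
    mulOp p (fun n => g n (n + k)) ⟨b k, hg k⟩ ∘L
      pullback p (fun n => n + k) (add_left_injective k)
  have hA : Summable A := by
    refine Summable.of_norm_bounded hb fun k => ?_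
    refine (ContinuousLinearMap.opNorm_comp_le _ _).trans ?_
    have hb0 : 0 ≤ b k := (abs_nonneg _).trans (hg k 0)
    calc _ ≤ b k * 1 := mul_le_mul (norm_mulOp_le p (hg k)) (norm_pullback_le p _ _)
          (norm_nonneg _) hb0
      _ = b k := mul_one _
  refine ⟨∑' k, A k, fun x n => ?_⟩
  have h1 := (ContinuousLinearMap.apply ℂ ℓ^p(ℤ, ℂ) x).hasSum hA.hasSum
  have h2 := (lp.evalCLM ℂ (fun _ : ℤ => ℂ) p n).hasSum h1
  rw [← (Equiv.addLeft n).hasSum_iff]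
  exact h2

section Kernel

variable {p : ℝ≥0∞} [Fact (1 ≤ p)] {v : ℤ → ℝ} {hv : ∃ C, ∀ n, |v n| ≤ C} {g : ℤ → ℤ → ℝ}
  {G : ℓ^p(ℤ, ℂ) →L[ℂ] ℓ^p(ℤ, ℂ)}

theorem hasSum_schrodinger_kernelOp
    (hG : ∀ x n, HasSum (fun m => (g n m : ℂ) * x m) (G x n)) (x : ℓ^p(ℤ, ℂ)) (n : ℤ) :
    HasSum (fun m => ((g (n + 1) m + g (n - 1) m + v n * g n m : ℝ) : ℂ) * x m)
      (schrodinger p v hv (G x) n) := by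
  rw [schrodinger_apply]
  convert ((hG x (n + 1)).add (hG x (n - 1))).add ((hG x n).mul_left (v n : ℂ)) using 2 with m
  push_cast
  ring

theorem hasSum_kernelOp_schrodinger
    (hG : ∀ x n, HasSum (fun m => (g n m : ℂ) * x m) (G x n)) (x : ℓ^p(ℤ, ℂ)) (n : ℤ) :
    HasSum (fun m => ((g n (m + 1) + g n (m - 1) + v m * g n m : ℝ) : ℂ) * x m)
      (G (schrodinger p v hv x) n) := by
  have h1 := (Equiv.addRight (-1 : ℤ)).hasSum_iff.2
    (hG (pullback p (fun n => n + 1) (add_left_injective (1 : ℤ)) x) n)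
  have h2 := (Equiv.addRight (1 : ℤ)).hasSum_iff.2
    (hG (pullback p (fun n => n - 1) (sub_left_injective (b := (1 : ℤ))) x) n)
  have h3 := hG (mulOp p v hv x) n
  convert (h1.add h2).add h3 using 1
  · funext m
    simp [← sub_eq_add_neg]
    ring
  · simp [schrodinger]

/-- The Green equation in the first variable gives a right inverse; symmetry transfers it to the
second variable, where it gives a left inverse. -/
theorem isUnit_schrodinger_of_kernel {b : ℤ → ℝ} (hb : Summable b)
    (hg : ∀ k n, |g n (n + k)| ≤ b k) (hsymm : ∀ n m, g n m = g m n)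
    (hgreen : ∀ n m, g (n + 1) m + g (n - 1) m + v n * g n m = if m = n then 1 else 0) :
    IsUnit (schrodinger p v hv) := by
  obtain ⟨G, hG⟩ := exists_kernelOp p hb hg
  have key : ∀ (x : ℓ^p(ℤ, ℂ)) (n : ℤ),
      HasSum (fun m => ((if m = n then (1 : ℝ) else 0 : ℝ) : ℂ) * x m) (x n) := fun x n => by
    convert hasSum_ite_eq n (x n) using 2 with m
    by_cases h : m = n <;> simp [h]
  refine ⟨⟨schrodinger p v hv, G, ?_, ?_⟩, rfl⟩
  · ext x n
    change schrodinger p v hv (G x) n = x n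
    refine (hasSum_schrodinger_kernelOp (hv := hv) hG x n).unique ?_
    simpa only [hgreen] using key x n
  · ext x n
    change G (schrodinger p v hv x) n = x n
    refine (hasSum_kernelOp_schrodinger (hv := hv) hG x n).unique ?_
    convert key x n using 4 with m
    rw [hsymm n (m + 1), hsymm n (m - 1), hsymm n m, hgreen]
    simp [eq_comm]

/-- A symmetric kernel vanishing for negative indices neither produces nor sees values on the
negative half line. Restriction and extension by zero can thus be inserted freely (`hERG`, `hGER`),
which reduces the claim to the two-sided computation. -/
theorem isUnit_schrodingerPlus_of_kernel {b : ℤ → ℝ} (hb : Summable b)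
    (hg : ∀ k n, |g n (n + k)| ≤ b k) (hsymm : ∀ n m, g n m = g m n)
    (hneg : ∀ n m, n < 0 → g n m = 0)
    (hgreen : ∀ n m, 0 ≤ n → 0 ≤ m →
      g (n + 1) m + g (n - 1) m + v n * g n m = if m = n then 1 else 0) :
    IsUnit (schrodingerPlus p v hv) := by
  obtain ⟨G, hG⟩ := exists_kernelOp p hb hg
  let R : ℓ^p(ℤ, ℂ) →L[ℂ] ℓ^p(ℕ, ℂ) := pullback p (fun n : ℕ => (n : ℤ)) Nat.cast_injective
  have key : ∀ (x : ℓ^p(ℕ, ℂ)) (n : ℕ),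
      HasSum (fun m => ((if m = (n : ℤ) then (1 : ℝ) else 0 : ℝ) : ℂ) * embed p x m)
        (x n) := fun x n => by
    convert hasSum_ite_eq (n : ℤ) (x n) using 2 with m
    by_cases h : m = n <;> simp [h, extendZero]
  have embed_neg : ∀ (x : ℓ^p(ℕ, ℂ)) (m : ℤ), ¬ 0 ≤ m → embed p x m = 0 := fun x m h => by
    simp [extendZero, h]
  have embed_R : ∀ (y : ℓ^p(ℤ, ℂ)) (m : ℤ), 0 ≤ m → embed p (R y) m = y m := fun y m h => by
    simp [extendZero, h, R]
  have hERG : ∀ y, embed p (R (G y)) = G y := fun y => by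
    ext m
    by_cases h : 0 ≤ m
    · exact embed_R _ m h
    · rw [embed_neg _ m h]
      refine HasSum.unique ?_ (hG y m)
      simp [hneg m _ (not_le.1 h)]
  have hGER : ∀ y, G (embed p (R y)) = G y := fun y => by
    ext n
    refine HasSum.unique (hG _ n) ?_
    convert hG y n using 2 with m
    by_cases h : 0 ≤ m
    · rw [embed_R _ m h]
    · simp [hsymm n m, hneg m _ (not_le.1 h)]
  refine ⟨⟨schrodingerPlus p v hv, R ∘L G ∘L embed p, ?_, ?_⟩, rfl⟩
  · ext x n
    change schrodinger p v hv (embed p (R (G (embed p x)))) n = x n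
    rw [hERG]
    refine (hasSum_schrodinger_kernelOp (hv := hv) hG _ n).unique ?_
    convert key x n using 2 with m
    by_cases h : 0 ≤ m
    · rw [hgreen n m (Int.natCast_nonneg n) h]
    · simp only [embed_neg x m h, mul_zero]
  · ext x n
    change G (embed p (R (schrodinger p v hv (embed p x)))) n = x n
    rw [hGER]
    refine (hasSum_kernelOp_schrodinger (hv := hv) hG _ n).unique ?_
    convert key x n using 2 with m
    by_cases h : 0 ≤ m
    · rw [hsymm n (m + 1), hsymm n (m - 1), hsymm n m, hgreen m n h (Int.natCast_nonneg n)]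
      simp [eq_comm]
    · simp only [embed_neg x m h, mul_zero]

end Kernel

/-! ### Solutions of the difference equation -/

/-- `φ` solves `φ(n+1) + φ(n-1) + v(n) φ(n) = 0` on `ℤ`. -/
def IsSolution {𝕜 : Type*} [RCLike 𝕜] (v : ℤ → ℝ) (φ : ℤ → 𝕜) : Prop :=
  ∀ n, φ (n + 1) + φ (n - 1) + (v n : 𝕜) * φ n = 0

/-- One step of the recurrence for the vectors `(φ r, φ (r - 1))`. The scalars are general because
the elliptic case needs complex eigenvectors, the hyperbolic one real ones. -/
theorem monodromy_map_succ_mulVec {𝕜 : Type*} [RCLike 𝕜] (v : ℤ → ℝ) (w : Fin 2 → 𝕜) (r : ℕ) :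
    ((monodromy v 0 (r + 1)).map (algebraMap ℝ 𝕜)).mulVec w =
      ![-(v r : 𝕜) * ((monodromy v 0 r).map (algebraMap ℝ 𝕜)).mulVec w 0
          - ((monodromy v 0 r).map (algebraMap ℝ 𝕜)).mulVec w 1,
        ((monodromy v 0 r).map (algebraMap ℝ 𝕜)).mulVec w 0] := by
  rw [monodromy, Matrix.map_mul, ← Matrix.mulVec_mulVec]
  generalize ((monodromy v 0 r).map (algebraMap ℝ 𝕜)).mulVec w = u
  ext i
  fin_cases i <;>
    simp [transferMatrix, Matrix.mulVec, dotProduct, Fin.sum_univ_two, sub_eq_add_neg]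

/-- An eigenvector of the monodromy matrix extends to a Floquet solution. -/
theorem exists_floquet {𝕜 : Type*} [RCLike 𝕜] {K : ℕ} (hK : 0 < K) {v : ℤ → ℝ}
    (hv : Function.Periodic v (K : ℤ)) {l : 𝕜} (hl : l ≠ 0) {w : Fin 2 → 𝕜}
    (hw : ((monodromy v 0 K).map (algebraMap ℝ 𝕜)).mulVec w = l • w) :
    ∃ φ : ℤ → 𝕜, IsSolution v φ ∧ (∀ n, φ (n + K) = l * φ n) ∧ φ 0 = w 0 ∧ φ (-1) = w 1 := by
  have hK' : (0 : ℤ) < K := by exact_mod_cast hK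
  -- The intended value is `(φ n, φ (n - 1))`: transfer within the period containing `n`, and one
  -- factor `l` per full period.
  let u : ℤ → Fin 2 → 𝕜 := fun n =>
    l ^ (n / K) • ((monodromy v 0 (n % K).toNat).map (algebraMap ℝ 𝕜)).mulVec w
  have hu : ∀ n, u (n + 1) = ![-(v n : 𝕜) * u n 0 - u n 1, u n 0] := by
    intro n
    have h0 : 0 ≤ n % (K : ℤ) := Int.emod_nonneg _ hK'.ne'
    have h1 : n % (K : ℤ) < K := Int.emod_lt_of_pos _ hK'
    have hn := Int.emod_add_mul_ediv n K
    set q := n / (K : ℤ) with hq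
    obtain ⟨r, hr⟩ := Int.eq_ofNat_of_zero_le h0
    have hvn : v n = v r := by
      rw [← hn, hr, mul_comm]
      exact hv.int_mul q _
    have hun : u n = l ^ q • ((monodromy v 0 r).map (algebraMap ℝ 𝕜)).mulVec w := by
      simp only [u, hr, ← hq]
      rfl
    have hsucc : u (n + 1) =
        l ^ q • ((monodromy v 0 (r + 1)).map (algebraMap ℝ 𝕜)).mulVec w := by
      rcases (show (r : ℤ) + 1 < K ∨ (r : ℤ) + 1 = K by omega) with h | h
      · have e1 : (n + 1) / (K : ℤ) = q := by
          rw [← hn, hr, show (r : ℤ) + K * q + 1 = (r + 1) + K * q by ring,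
            Int.add_mul_ediv_left _ _ hK'.ne', Int.ediv_eq_zero_of_lt (by omega) h, zero_add]
        have e2 : (n + 1) % (K : ℤ) = (r + 1 : ℕ) := by
          rw [← hn, hr, show (r : ℤ) + K * q + 1 = (r + 1) + K * q by ring,
            Int.add_mul_emod_self_left, Int.emod_eq_of_lt (by omega) h]
          rfl
        simp only [u, e1, e2, Int.toNat_natCast]
      -- At the end of a period the eigenvector equation turns the full product of transfer matrices
      -- into one more factor `l`.
      · have e0 : n + 1 = K * (q + 1) := by rw [← hn, hr, ← h]; ring
        have e1 : (n + 1) / (K : ℤ) = q + 1 := by rw [e0, Int.mul_ediv_cancel_left _ hK'.ne']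
        have e2 : (n + 1) % (K : ℤ) = 0 := by rw [e0, Int.mul_emod_right]
        have e3 : r + 1 = K := by exact_mod_cast h
        simp only [u, e1, e2, e3, hw, zpow_add_one₀ hl, mul_smul]
        simp [monodromy]
    rw [hsucc, hun, monodromy_map_succ_mulVec, hvn]
    ext i
    fin_cases i
    · simp
      ring
    · simp
  have hu1 : ∀ n, u n 1 = u (n - 1) 0 := fun n => by
    have := hu (n - 1)
    rw [sub_add_cancel] at this
    simp [this]
  refine ⟨fun n => u n 0, fun n => ?_, fun n => ?_, ?_, ?_⟩
  · simp only [hu n, ← hu1]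
    simp
  · simp only [u, Int.add_emod_right, Int.add_ediv_of_dvd_right (dvd_refl _),
      Int.ediv_self hK'.ne', zpow_add_one₀ hl, Pi.smul_apply, smul_eq_mul]
    ring
  · simp [u, monodromy]
  · change u (-1) 0 = w 1
    have := hu1 0
    rw [zero_sub] at this
    rw [← this]
    simp [u, monodromy]

/-- The growth of a function that is quasi-periodic with multiplier of modulus `ρ ^ K`. -/
theorem exists_bound_of_quasiPeriodic {𝕜 : Type*} [RCLike 𝕜] {K : ℕ} (hK : 0 < K) {l : 𝕜}
    {ρ : ℝ} (hρ : 0 < ρ) (hl : ‖l‖ = ρ ^ K) {φ : ℤ → 𝕜} (hφ : ∀ n, φ (n + K) = l * φ n) :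
    ∃ C, ∀ n, ‖φ n‖ ≤ C * ρ ^ n := by
  -- Dividing by `ρ ^ n` cancels the growth of the modulus and leaves a periodic, hence bounded,
  -- function.
  have hper : Function.Periodic (fun n => ‖φ n‖ / ρ ^ n) (K : ℤ) := fun n => by
    simp only [hφ, norm_mul, hl, zpow_add₀ hρ.ne', zpow_natCast]
    field_simp
  obtain ⟨C, hC⟩ := bounded_of_periodic hK hper
  exact ⟨C, fun n => (div_le_iff₀ (zpow_pos hρ n)).1 ((le_abs_self _).trans (hC n))⟩

/-- The Wronskian of two solutions is constant. -/
theorem wronskian_eq {v : ℤ → ℝ} {φ ψ : ℤ → ℝ} (hφ : IsSolution v φ) (hψ : IsSolution v ψ)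
    (n : ℤ) : ψ n * φ (n + 1) - φ n * ψ (n + 1) = ψ (-1) * φ 0 - φ (-1) * ψ 0 := by
  have step : ∀ n, ψ n * φ (n + 1) - φ n * ψ (n + 1) =
      ψ (n - 1) * φ n - φ (n - 1) * ψ n := fun n => by
    have h1 := hφ n
    have h2 := hψ n
    simp only [RCLike.ofReal_real_eq_id, id] at h1 h2
    linear_combination ψ n * h1 - φ n * h2
  induction n using Int.induction_on with
  | zero => simpa using step 0
  | succ i ih => rw [step, add_sub_cancel_right, ih]
  | pred i ih => rw [← ih, step (-i), sub_add_cancel]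

/-! ### The monodromy matrix -/

theorem det_monodromy (v : ℤ → ℝ) (E : ℝ) (k : ℕ) : (monodromy v E k).det = 1 := by
  induction k with
  | zero => simp [monodromy]
  | succ k ih =>
    rw [monodromy, Matrix.det_mul, ih]
    simp [transferMatrix]

theorem exists_eigenvector {𝕜 : Type*} [Field 𝕜] (M : Matrix (Fin 2) (Fin 2) 𝕜) {l : 𝕜}
    (hl : l ^ 2 - M.trace * l + M.det = 0) : ∃ w, w ≠ 0 ∧ M.mulVec w = l • w := by
  have : (M - l • 1).det = 0 := by
    rw [← hl]
    simp [Matrix.det_fin_two, Matrix.trace_fin_two]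
    ring
  obtain ⟨w, hw, h⟩ := Matrix.exists_mulVec_eq_zero_iff.2 this
  refine ⟨w, hw, ?_⟩
  rwa [Matrix.sub_mulVec, Matrix.smul_mulVec, Matrix.one_mulVec, sub_eq_zero] at h

/-- Eigenvectors for distinct eigenvalues are independent; the expression is, up to sign, their
determinant and later becomes the Wronskian. -/
theorem cross_ne_zero_of_eigenvectors {𝕜 : Type*} [Field 𝕜] {M : Matrix (Fin 2) (Fin 2) 𝕜}
    {l m : 𝕜} (hlm : l ≠ m) {w u : Fin 2 → 𝕜} (hw0 : w ≠ 0) (hu0 : u ≠ 0)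
    (hw : M.mulVec w = l • w) (hu : M.mulVec u = m • u) : w 1 * u 0 - u 1 * w 0 ≠ 0 := by
  intro h
  have hcomb : ∀ i, u i • w = w i • u := fun i => by
    ext j
    fin_cases i <;> fin_cases j <;> simp <;> first | ring1 | linear_combination h |
      linear_combination -h
  obtain ⟨i, hi⟩ := Function.ne_iff.1 hw0
  obtain ⟨j, hj⟩ := Function.ne_iff.1 hu0
  have h1 := congrArg M.mulVec (hcomb i)
  rw [Matrix.mulVec_smul, Matrix.mulVec_smul, hw, hu, smul_comm, hcomb i, smul_comm (w i)] at h1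
  have h2 := congrFun h1 j
  simp only [Pi.smul_apply, smul_eq_mul] at h2
  exact hlm (mul_right_cancel₀ (mul_ne_zero hi hj) h2)

theorem exists_unimodular_root {t : ℝ} (ht : |t| ≤ 2) :
    ∃ l : ℂ, ‖l‖ = 1 ∧ l ^ 2 - t * l + 1 = 0 := by
  have h4 : 0 ≤ 1 - (t / 2) ^ 2 := by nlinarith [(abs_le.1 ht).1, (abs_le.1 ht).2]
  have hs := Real.sq_sqrt h4
  set s := √(1 - (t / 2) ^ 2)
  refine ⟨⟨t / 2, s⟩, ?_, ?_⟩
  · rw [Complex.norm_def, Real.sqrt_eq_one, Complex.normSq_mk]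
    linarith
  · apply Complex.ext <;> simp [pow_two] <;> linarith

theorem exists_hyperbolic_roots {t : ℝ} (ht : 2 < |t|) :
    ∃ l₁ l₂ : ℝ, l₁ + l₂ = t ∧ l₁ * l₂ = 1 ∧ |l₂| < 1 ∧ 1 < |l₁| := by
  have h4 : 0 ≤ t ^ 2 - 4 := by nlinarith [sq_abs t]
  have hs := Real.sq_sqrt h4
  have hs0 := Real.sqrt_nonneg (t ^ 2 - 4)
  set s := √(t ^ 2 - 4)
  have key : ∃ l₁ l₂ : ℝ, l₁ + l₂ = t ∧ l₁ * l₂ = 1 ∧ 1 < |l₁| := by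
    rcases lt_abs.1 ht with h | h
    · exact ⟨(t + s) / 2, (t - s) / 2, by ring, by nlinarith, lt_abs.2 (Or.inl (by linarith))⟩
    · exact ⟨(t - s) / 2, (t + s) / 2, by ring, by nlinarith, lt_abs.2 (Or.inr (by linarith))⟩
  obtain ⟨l₁, l₂, h1, h2, h3⟩ := key
  refine ⟨l₁, l₂, h1, h2, ?_, h3⟩
  have h5 : |l₁| * |l₂| = 1 := by rw [← abs_mul, h2, abs_one]
  by_contra! h6
  nlinarith [abs_nonneg l₂]

theorem charpoly_roots_eq {M : Matrix (Fin 2) (Fin 2) ℝ} {l₁ l₂ : ℝ} (htr : l₁ + l₂ = M.trace)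
    (hdet : l₁ * l₂ = M.det) : M.charpoly.roots = {l₁, l₂} := by
  have h : M.charpoly = (Polynomial.X - Polynomial.C l₁) * (Polynomial.X - Polynomial.C l₂) := by
    rw [Matrix.charpoly_fin_two, ← htr, ← hdet, Polynomial.C_add, Polynomial.C_mul]
    ring
  rw [h, Polynomial.roots_mul
    (mul_ne_zero (Polynomial.X_sub_C_ne_zero _) (Polynomial.X_sub_C_ne_zero _)),
    Polynomial.roots_X_sub_C, Polynomial.roots_X_sub_C]
  rfl

/-! ### Non-invertibility from a bounded solution -/

theorem summable_pow_natAbs {a : ℝ} (h0 : 0 ≤ a) (h1 : a < 1) :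
    Summable fun n : ℤ => a ^ n.natAbs := by
  refine Summable.of_nat_of_neg ?_ ?_ <;> simpa using summable_geometric_of_lt_one h0 h1

theorem memlp_of_norm_le {α : Type*} {p : ℝ≥0∞} [Fact (1 ≤ p)] {x : α → ℂ} {b : α → ℝ}
    (hb : Summable b) (h : ∀ n, ‖x n‖ ≤ b n) : Memℓp x p := by
  refine Memℓp.of_exponent_ge (q := 1) ?_ Fact.out
  rw [memℓp_gen_iff (by simp)]
  simpa using Summable.of_nonneg_of_le (fun n => norm_nonneg _) h hb

/-- The damping weight changes between neighbouring sites by a relative amount of at most `c`. -/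
theorem abs_pow_sub_pow_le {c : ℝ} (hc : 0 < c) {i j : ℕ} (hij : i = j + 1 ∨ j = i + 1) :
    |(1 + c)⁻¹ ^ i - (1 + c)⁻¹ ^ j| ≤ c * (1 + c)⁻¹ ^ i := by
  have ha : 0 < (1 + c)⁻¹ := by positivity
  have ha1 : (1 + c)⁻¹ * (1 + c) = 1 := inv_mul_cancel₀ (by positivity)
  set a := (1 + c)⁻¹
  rcases hij with rfl | rfl
  · have : 0 < a ^ j := pow_pos ha j
    have h2 : a ^ (j + 1) - a ^ j = -(c * a ^ (j + 1)) := by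
      rw [pow_succ]
      linear_combination a ^ j * ha1
    rw [h2, abs_neg, abs_of_pos (by positivity)]
  · have : 0 < a ^ i := pow_pos ha i
    have h2 : a ^ i - a ^ (i + 1) = c * a ^ i * a := by
      rw [pow_succ]
      linear_combination -a ^ i * ha1
    rw [h2, abs_of_pos (by positivity)]
    have : a ≤ 1 := by nlinarith
    exact mul_le_of_le_one_right (by positivity) this

/-- A bounded solution, damped by the slowly decaying weight `(1 + c)^{-|n|}`, is an approximate
null vector of `H` in every `ℓ^p(ℤ)`. -/
theorem exists_approximate_null_vector (p : ℝ≥0∞) [Fact (1 ≤ p)] {v : ℤ → ℝ}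
    (hv : ∃ C, ∀ n, |v n| ≤ C) {x : ℤ → ℂ} (hx : IsSolution v x) (hx0 : x ≠ 0) {B : ℝ}
    (hB : ∀ n, ‖x n‖ ≤ B) {c : ℝ} (hc : 0 < c) :
    ∃ y : ℓ^p(ℤ, ℂ), y ≠ 0 ∧ ‖schrodinger p v hv y‖ ≤ c * (2 * ‖y‖) := by
  have ha : 0 < (1 + c)⁻¹ := by positivity
  have ha1 : (1 + c)⁻¹ < 1 := inv_lt_one_of_one_lt₀ (by linarith)
  have hpow := fun {i j : ℕ} (h : i = j + 1 ∨ j = i + 1) => abs_pow_sub_pow_le hc h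
  set a := (1 + c)⁻¹
  have hnorm : ∀ n : ℤ, ‖((a ^ n.natAbs : ℝ) : ℂ) * x n‖ = a ^ n.natAbs * ‖x n‖ := fun n => by
    rw [norm_mul, Complex.norm_real, Real.norm_of_nonneg (pow_nonneg ha.le _)]
  have hmem : Memℓp (fun n : ℤ => ((a ^ n.natAbs : ℝ) : ℂ) * x n) p := by
    refine memlp_of_norm_le ((summable_pow_natAbs ha.le ha1).mul_right B) fun n => ?_
    rw [hnorm]
    exact mul_le_mul_of_nonneg_left (hB n) (pow_nonneg ha.le _)
  have hmem' : Memℓp (fun n : ℤ => ((a ^ n.natAbs * ‖x n‖ : ℝ) : ℂ)) p := by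
    refine memlp_of_norm_le ((summable_pow_natAbs ha.le ha1).mul_right B) fun n => ?_
    rw [Complex.norm_real, Real.norm_of_nonneg (by positivity)]
    exact mul_le_mul_of_nonneg_left (hB n) (pow_nonneg ha.le _)
  let y : ℓ^p(ℤ, ℂ) := ⟨_, hmem⟩
  -- The coordinatewise modulus of `y`: its shifts add without cancellation, so they can dominate `H
  -- y` pointwise.
  let z : ℓ^p(ℤ, ℂ) := ⟨_, hmem'⟩
  have hy : ∀ n, y n = ((a ^ n.natAbs : ℝ) : ℂ) * x n := fun n => rfl
  have hz : ∀ n, z n = ((a ^ n.natAbs * ‖x n‖ : ℝ) : ℂ) := fun n => rfl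
  have hzy : ‖z‖ ≤ ‖y‖ := lp.norm_mono (exponent_ne_zero p) fun n => by
    rw [hy, hz, hnorm, Complex.norm_real, Real.norm_of_nonneg (by positivity)]
  refine ⟨y, ?_, ?_⟩
  · obtain ⟨n, hn⟩ := Function.ne_iff.1 hx0
    intro h
    have h' : y n = 0 := by rw [h]; rfl
    rw [hy] at h'
    refine mul_ne_zero ?_ hn h'
    exact_mod_cast (pow_pos ha n.natAbs).ne'
  · let s₁ := pullback p (fun n : ℤ => n + 1) (add_left_injective (1 : ℤ)) z
    let s₂ := pullback p (fun n : ℤ => n - 1) (sub_left_injective (b := (1 : ℤ))) z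
    have hs₁ : ‖s₁‖ ≤ ‖z‖ := norm_comp_le (add_left_injective (1 : ℤ)) z
    have hs₂ : ‖s₂‖ ≤ ‖z‖ := norm_comp_le (sub_left_injective (b := (1 : ℤ))) z
    have hle : ‖schrodinger p v hv y‖ ≤ ‖(c : ℂ) • (s₁ + s₂)‖ := by
      refine lp.norm_mono (exponent_ne_zero p) fun n => ?_
      -- Subtracting `a ^ |n|` times the equation for `x` leaves only differences of weights.
      have e1 : schrodinger p v hv y n =
          ((a ^ (n + 1).natAbs - a ^ n.natAbs : ℝ) : ℂ) * x (n + 1) +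
          ((a ^ (n - 1).natAbs - a ^ n.natAbs : ℝ) : ℂ) * x (n - 1) := by
        have h : x (n + 1) + x (n - 1) + (v n : ℂ) * x n = 0 := hx n
        rw [schrodinger_apply, hy, hy, hy]
        push_cast
        linear_combination (a : ℂ) ^ n.natAbs * h
      have e2 : ((c : ℂ) • (s₁ + s₂)) n = ((c * (a ^ (n + 1).natAbs * ‖x (n + 1)‖ +
          a ^ (n - 1).natAbs * ‖x (n - 1)‖) : ℝ) : ℂ) := by
        change (c : ℂ) * (z (n + 1) + z (n - 1)) = _
        rw [hz, hz]
        push_cast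
        ring
      rw [e1, e2, Complex.norm_real, Real.norm_of_nonneg (by positivity), mul_add,
        ← mul_assoc, ← mul_assoc]
      refine (norm_add_le _ _).trans (add_le_add ?_ ?_) <;>
      · rw [norm_mul, Complex.norm_real, Real.norm_eq_abs]
        exact mul_le_mul_of_nonneg_right (hpow (by omega)) (norm_nonneg _)
    refine hle.trans ?_
    rw [norm_smul, Complex.norm_real, Real.norm_of_nonneg hc.le]
    refine mul_le_mul_of_nonneg_left ((norm_add_le _ _).trans ?_) hc.le
    linarith

theorem not_isUnit_schrodinger_of_bounded_solution (p : ℝ≥0∞) [Fact (1 ≤ p)] {v : ℤ → ℝ}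
    (hv : ∃ C, ∀ n, |v n| ≤ C) {x : ℤ → ℂ} (hx : IsSolution v x) (hx0 : x ≠ 0) {B : ℝ}
    (hB : ∀ n, ‖x n‖ ≤ B) : ¬ IsUnit (schrodinger p v hv) := by
  rintro ⟨u, hu⟩
  set A : ℓ^p(ℤ, ℂ) →L[ℂ] ℓ^p(ℤ, ℂ) := ↑u⁻¹
  -- With this `c`, `‖A‖ * ‖H y‖` is at most half of `‖y‖`, contradicting `A (H y) = y`.
  have hc : 0 < (4 * (‖A‖ + 1))⁻¹ := by positivity
  obtain ⟨y, hy0, hy⟩ := exists_approximate_null_vector p hv hx hx0 hB hc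
  have h1 : A (schrodinger p v hv y) = y := by
    rw [← hu]
    exact congrArg (fun T : ℓ^p(ℤ, ℂ) →L[ℂ] ℓ^p(ℤ, ℂ) => T y) u.inv_mul
  have h2 : ‖y‖ ≤ ‖A‖ * ‖schrodinger p v hv y‖ := by
    conv_lhs => rw [← h1]
    exact A.le_opNorm _
  have hypos : 0 < ‖y‖ := norm_pos_iff.2 hy0
  have h3 : ‖schrodinger p v hv y‖ * (4 * (‖A‖ + 1)) ≤ 2 * ‖y‖ := by
    rwa [inv_mul_eq_div, le_div_iff₀ (by positivity)] at hy
  nlinarith [norm_nonneg (schrodinger p v hv y)]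

theorem not_isUnit_schrodinger_of_abs_trace_le {K : ℕ} (hK : 0 < K) {v : ℤ → ℝ}
    (hv : Function.Periodic v (K : ℤ)) (h : |(monodromy v 0 K).trace| ≤ 2) (p : ℝ≥0∞)
    [Fact (1 ≤ p)] : ¬ IsUnit (schrodinger p v (bounded_of_periodic hK hv)) := by
  obtain ⟨l, hl1, hl⟩ := exists_unimodular_root h
  have hl0 : l ≠ 0 := fun h0 => by simp [h0] at hl1
  obtain ⟨w, hw0, hw⟩ := exists_eigenvector ((monodromy v 0 K).map (algebraMap ℝ ℂ)) (l := l) (by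
    rw [← hl]
    have hdet := det_monodromy v 0 K
    rw [Matrix.det_fin_two] at hdet
    have hdet' := congrArg (fun r : ℝ => (r : ℂ)) hdet
    push_cast at hdet'
    simp only [Matrix.det_fin_two, Matrix.trace_fin_two, Matrix.map_apply,
      Complex.coe_algebraMap, Complex.ofReal_add]
    linear_combination hdet')
  obtain ⟨φ, hφ, hper, h0, h1⟩ := exists_floquet hK hv hl0 hw
  obtain ⟨C, hC⟩ := exists_bound_of_quasiPeriodic hK one_pos (by simpa using hl1) hper
  refine not_isUnit_schrodinger_of_bounded_solution p _ hφ ?_ (B := C) (by simpa using hC)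
  rintro rfl
  refine hw0 (funext fun i => ?_)
  fin_cases i
  · exact h0.symm
  · exact h1.symm

/-! ### Green kernels -/

/-- The Green kernel built from two solutions `φ`, `ψ` with Wronskian `W`. -/
noncomputable def greenKernel (φ ψ : ℤ → ℝ) (W : ℝ) (n m : ℤ) : ℝ := φ (min n m) * ψ (max n m) / W

theorem greenKernel_symm (φ ψ : ℤ → ℝ) (W : ℝ) (n m : ℤ) :
    greenKernel φ ψ W n m = greenKernel φ ψ W m n := by
  rw [greenKernel, greenKernel, min_comm, max_comm]

/-- Off the diagonal one factor is frozen and the other solves the equation; on the diagonal the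
defect is the Wronskian divided by `W`. -/
theorem greenKernel_equation {v φ ψ : ℤ → ℝ} (hφ : IsSolution v φ) (hψ : IsSolution v ψ) {W : ℝ}
    (hW0 : W ≠ 0) (hW : ∀ n, φ n * ψ (n + 1) - ψ n * φ (n + 1) = W) (n m : ℤ) :
    greenKernel φ ψ W (n + 1) m + greenKernel φ ψ W (n - 1) m + v n * greenKernel φ ψ W n m =
      if m = n then 1 else 0 := by
  have h1 : φ (n + 1) + φ (n - 1) + v n * φ n = 0 := hφ n
  have h2 : ψ (n + 1) + ψ (n - 1) + v n * ψ n = 0 := hψ n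
  simp only [greenKernel]
  rcases lt_trichotomy n m with h | rfl | h
  · rw [if_neg h.ne', min_eq_left (by omega), min_eq_left (by omega), min_eq_left h.le,
      max_eq_right (by omega), max_eq_right (by omega), max_eq_right h.le]
    linear_combination ψ m / W * h1
  · rw [if_pos rfl, min_eq_right (by omega), min_eq_left (by omega), min_self,
      max_eq_left (by omega), max_eq_right (by omega), max_self]
    field_simp
    linear_combination hW n + ψ n * h1
  · rw [if_neg h.ne, min_eq_right (by omega), min_eq_right (by omega), min_eq_right h.le,
      max_eq_left (by omega), max_eq_left (by omega), max_eq_left h.le]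
    linear_combination φ m / W * h2

theorem abs_greenKernel_le {φ ψ : ℤ → ℝ} {W ρ C D : ℝ} (hρ : 0 < ρ) {n k : ℤ}
    (hφ : |φ (min n (n + k))| ≤ C * (ρ ^ min n (n + k))⁻¹)
    (hψ : |ψ (max n (n + k))| ≤ D * ρ ^ max n (n + k)) :
    |greenKernel φ ψ W n (n + k)| ≤ C * D / |W| * ρ ^ k.natAbs := by
  rw [greenKernel, abs_div, abs_mul, div_mul_eq_mul_div]
  refine div_le_div_of_nonneg_right ?_ (abs_nonneg _)
  refine (mul_le_mul hφ hψ (abs_nonneg _) ((abs_nonneg _).trans hφ)).trans_eq ?_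
  have : ρ ^ max n (n + k) = ρ ^ min n (n + k) * ρ ^ k.natAbs := by
    rw [← zpow_natCast, ← zpow_add₀ hρ.ne']
    congr 1
    omega
  rw [this]
  have := (zpow_pos hρ (min n (n + k))).ne'
  field_simp

variable {K : ℕ} {v : ℤ → ℝ}

/-- In the hyperbolic case there is a pair of solutions with opposite exponential behaviour and
nonzero Wronskian. -/
theorem exists_dichotomy (hK : 0 < K) (hv : Function.Periodic v (K : ℤ)) {l₁ l₂ : ℝ}
    (htr : l₁ + l₂ = (monodromy v 0 K).trace) (hdet : l₁ * l₂ = 1) (h2 : |l₂| < 1)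
    (h1 : 1 < |l₁|) :
    ∃ (φ ψ : ℤ → ℝ) (ρ C D W : ℝ), 0 < ρ ∧ ρ < 1 ∧ IsSolution v φ ∧ IsSolution v ψ ∧
      (∀ n, |φ n| ≤ C * (ρ ^ n)⁻¹) ∧ (∀ n, |ψ n| ≤ D * ρ ^ n) ∧ W ≠ 0 ∧
      (∀ n, φ n * ψ (n + 1) - ψ n * φ (n + 1) = W) ∧
      ![ψ 0, ψ (-1)] ≠ 0 ∧
      (monodromy v 0 K).mulVec ![ψ 0, ψ (-1)] = l₂ • ![ψ 0, ψ (-1)] := by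
  have hl₁ : l₁ ≠ 0 := left_ne_zero_of_mul_eq_one hdet
  have hl₂ : l₂ ≠ 0 := right_ne_zero_of_mul_eq_one hdet
  have hne : l₁ ≠ l₂ := fun h => by rw [h] at h1; linarith
  have hd := det_monodromy v 0 K
  set M := monodromy v 0 K with hM
  have hmap : ∀ w, (M.map (algebraMap ℝ ℝ)).mulVec w = M.mulVec w := fun w => rfl
  obtain ⟨u, hu0, hu⟩ := exists_eigenvector M (l := l₁)
    (by rw [← htr, hd]; linear_combination -hdet)
  obtain ⟨w, hw0, hw⟩ := exists_eigenvector M (l := l₂)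
    (by rw [← htr, hd]; linear_combination -hdet)
  obtain ⟨φ, hφ, hφK, hφ0, hφ1⟩ := exists_floquet hK hv hl₁ ((hmap u).trans hu)
  obtain ⟨ψ, hψ, hψK, hψ0, hψ1⟩ := exists_floquet hK hv hl₂ ((hmap w).trans hw)
  have hl₂pos : 0 < |l₂| := abs_pos.2 hl₂
  -- The decay rate per site, a `K`-th root of the rate per period.
  let ρ : ℝ := |l₂| ^ ((K : ℝ)⁻¹)
  have hρ : 0 < ρ := Real.rpow_pos_of_pos hl₂pos _
  have hρ1 : ρ < 1 := Real.rpow_lt_one hl₂pos.le h2 (by positivity)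
  have hρK : ρ ^ K = |l₂| := Real.rpow_inv_natCast_pow hl₂pos.le hK.ne'
  have hl₁K : |l₁| = ρ⁻¹ ^ K := by
    rw [inv_pow, hρK]
    exact eq_inv_of_mul_eq_one_left (by rw [← abs_mul, hdet, abs_one])
  obtain ⟨C, hC⟩ := exists_bound_of_quasiPeriodic hK (inv_pos.2 hρ) hl₁K hφK
  obtain ⟨D, hD⟩ := exists_bound_of_quasiPeriodic hK hρ hρK.symm hψK
  have hwv : ![ψ 0, ψ (-1)] = w := by
    ext i
    fin_cases i
    · exact hψ0
    · exact hψ1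
  refine ⟨φ, ψ, ρ, C, D, φ (-1) * ψ 0 - ψ (-1) * φ 0, hρ, hρ1, hφ, hψ, ?_, hD, ?_,
    wronskian_eq hψ hφ, by rwa [hwv], by rwa [hwv]⟩
  · intro n
    rw [← inv_zpow]
    exact hC n
  · rw [hφ0, hφ1, hψ0, hψ1]
    exact cross_ne_zero_of_eigenvectors hne hu0 hw0 hu hw

theorem isUnit_schrodinger_of_hyperbolic (hK : 0 < K) (hv : Function.Periodic v (K : ℤ))
    (ht : 2 < |(monodromy v 0 K).trace|) (p : ℝ≥0∞) [Fact (1 ≤ p)] :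
    IsUnit (schrodinger p v (bounded_of_periodic hK hv)) := by
  obtain ⟨l₁, l₂, htr, hdet, h2, h1⟩ := exists_hyperbolic_roots ht
  obtain ⟨φ, ψ, ρ, C, D, W, hρ, hρ1, hφ, hψ, hC, hD, hW0, hW, -, -⟩ :=
    exists_dichotomy hK hv htr hdet h2 h1
  exact isUnit_schrodinger_of_kernel ((summable_pow_natAbs hρ.le hρ1).mul_left (C * D / |W|))
    (fun k n => abs_greenKernel_le hρ (hC _) (hD _)) (greenKernel_symm φ ψ W)
    (greenKernel_equation hφ hψ hW0 hW)

/-- If the decaying solution does not satisfy the Dirichlet condition, then `H₊` is invertible. -/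
theorem isUnit_schrodingerPlus_of_not_eigenvector (hK : 0 < K)
    (hv : Function.Periodic v (K : ℤ)) {l₁ l₂ : ℝ}
    (htr : l₁ + l₂ = (monodromy v 0 K).trace) (hdet : l₁ * l₂ = 1) (h2 : |l₂| < 1)
    (h1 : 1 < |l₁|)
    (hnot : ¬ Module.End.HasEigenvector (Matrix.toLin' (monodromy v 0 K)) l₂ ![1, 0])
    (p : ℝ≥0∞) [Fact (1 ≤ p)] :
    IsUnit (schrodingerPlus p v (bounded_of_periodic hK hv)) := by
  obtain ⟨φ, ψ, ρ, C, D, W, hρ, hρ1, hφ, hψ, hC, hD, hW0, hW, hw0, hw⟩ :=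
    exists_dichotomy hK hv htr hdet h2 h1
  have hψ1 : ψ (-1) ≠ 0 := by
    intro h
    rw [h] at hw hw0
    have hψ0 : ψ 0 ≠ 0 := fun h0 => hw0 (by simp [h0])
    have hvec : ![ψ 0, 0] = ψ 0 • ![(1 : ℝ), 0] := by simp
    refine hnot ⟨Module.End.mem_eigenspace_iff.2 ?_, by simp⟩
    rw [Matrix.toLin'_apply]
    rw [hvec, Matrix.mulVec_smul, smul_comm] at hw
    exact smul_right_injective _ hψ0 hw
  -- The combination satisfying the Dirichlet condition at `-1`; its Wronskian with `ψ` is `ψ (-1) *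
  -- W`.
  let χ : ℤ → ℝ := fun n => ψ (-1) * φ n - φ (-1) * ψ n
  have hχ : IsSolution v χ := fun n => by
    have h1 : φ (n + 1) + φ (n - 1) + v n * φ n = 0 := hφ n
    have h2 : ψ (n + 1) + ψ (n - 1) + v n * ψ n = 0 := hψ n
    change (ψ (-1) * φ (n + 1) - φ (-1) * ψ (n + 1)) + (ψ (-1) * φ (n - 1) - φ (-1) * ψ (n - 1)) +
      v n * (ψ (-1) * φ n - φ (-1) * ψ n) = 0
    linear_combination ψ (-1) * h1 - φ (-1) * h2
  have hχ1 : χ (-1) = 0 := by simp only [χ]; ring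
  have hχW : ∀ n, χ n * ψ (n + 1) - ψ n * χ (n + 1) = ψ (-1) * W := fun n => by
    simp only [χ]
    linear_combination ψ (-1) * hW n
  have hD0 : 0 ≤ D := by simpa using (abs_nonneg _).trans (hD 0)
  -- The `ψ` part of `χ` may grow to the left, but for `n ≥ 0` it is absorbed because `ρ ^ n ≤ (ρ ^
  -- n)⁻¹`.
  have hχb : ∀ n : ℤ, 0 ≤ n → |χ n| ≤ (|ψ (-1)| * C + |φ (-1)| * D) * (ρ ^ n)⁻¹ := by
    intro n hn
    have hle : ρ ^ n ≤ (ρ ^ n)⁻¹ := by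
      have h : ρ ^ n ≤ 1 := by
        lift n to ℕ using hn
        rw [zpow_natCast]
        exact pow_le_one₀ hρ.le hρ1.le
      exact h.trans ((one_le_inv₀ (zpow_pos hρ n)).2 h)
    calc |χ n| ≤ |ψ (-1) * φ n| + |φ (-1) * ψ n| := abs_sub _ _
      _ = |ψ (-1)| * |φ n| + |φ (-1)| * |ψ n| := by rw [abs_mul, abs_mul]
      _ ≤ |ψ (-1)| * (C * (ρ ^ n)⁻¹) + |φ (-1)| * (D * (ρ ^ n)⁻¹) :=
        add_le_add (mul_le_mul_of_nonneg_left (hC n) (abs_nonneg _))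
          (mul_le_mul_of_nonneg_left ((hD n).trans (mul_le_mul_of_nonneg_left hle hD0))
            (abs_nonneg _))
      _ = _ := by ring
  set C' := |ψ (-1)| * C + |φ (-1)| * D
  have hC' : 0 ≤ C' := by simpa using (abs_nonneg _).trans (hχb 0 le_rfl)
  refine isUnit_schrodingerPlus_of_kernel
    (g := fun n m => if 0 ≤ n ∧ 0 ≤ m then greenKernel χ ψ (ψ (-1) * W) n m else 0)
    ((summable_pow_natAbs hρ.le hρ1).mul_left (C' * D / |ψ (-1) * W|)) ?_ ?_ ?_ ?_
  · intro k n
    split_ifs with h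
    · exact abs_greenKernel_le hρ (hχb _ (le_min h.1 h.2)) (hD _)
    · rw [abs_zero]
      positivity
  · intro n m
    simp only [and_comm, greenKernel_symm _ _ _ n m]
  · intro n m hn
    rw [if_neg (by omega)]
  · intro n m hn hm
    rw [← greenKernel_equation hχ hψ (mul_ne_zero hψ1 hW0) hχW n m]
    congr 2
    · exact if_pos ⟨by omega, hm⟩
    -- At `n = 0` the truncation removes the entry with first index `-1`, which is already zero
    -- since `χ (-1) = 0`.
    · rcases hn.eq_or_lt with rfl | hn'
      · rw [if_neg (by omega), greenKernel, min_eq_left (by omega), zero_sub, hχ1]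
        simp
      · exact if_pos ⟨by omega, hm⟩
    · exact if_pos ⟨hn, hm⟩

theorem not_injective_schrodingerPlus_of_eigenvector (hK : 0 < K)
    (hv : Function.Periodic v (K : ℤ)) {l : ℝ} (hl0 : l ≠ 0) (hl : |l| < 1)
    (h : Module.End.HasEigenvector (Matrix.toLin' (monodromy v 0 K)) l ![1, 0])
    (p : ℝ≥0∞) [Fact (1 ≤ p)] :
    ¬ Function.Injective (schrodingerPlus p v (bounded_of_periodic hK hv)) := by
  have hw : ((monodromy v 0 K).map (algebraMap ℝ ℝ)).mulVec ![1, 0] = l • ![1, 0] :=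
    Module.End.mem_eigenspace_iff.1 h.1
  obtain ⟨φ, hφ, hφK, hφ0, hφ1⟩ := exists_floquet hK hv hl0 hw
  have hlpos : 0 < |l| := abs_pos.2 hl0
  have hρK : (|l| ^ ((K : ℝ)⁻¹)) ^ K = |l| := Real.rpow_inv_natCast_pow hlpos.le hK.ne'
  have hρ : 0 < |l| ^ ((K : ℝ)⁻¹) := Real.rpow_pos_of_pos hlpos _
  have hρ1 : |l| ^ ((K : ℝ)⁻¹) < 1 := Real.rpow_lt_one hlpos.le hl (by positivity)
  obtain ⟨C, hC⟩ := exists_bound_of_quasiPeriodic hK hρ hρK.symm hφK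
  have hmem : Memℓp (fun n : ℕ => (φ n : ℂ)) p :=
    memlp_of_norm_le ((summable_geometric_of_lt_one hρ.le hρ1).mul_left C) fun n => by
      rw [Complex.norm_real]
      simpa using hC n
  let x : ℓ^p(ℕ, ℂ) := ⟨_, hmem⟩
  have hx : ∀ n : ℕ, x n = (φ n : ℂ) := fun n => rfl
  have hsol : ∀ n : ℤ, φ (n + 1) + φ (n - 1) + v n * φ n = 0 := hφ
  intro hinj
  have hx0 : x = 0 := by
    refine hinj ?_
    rw [map_zero]
    ext n
    cases n with
    | zero =>
      rw [schrodingerPlus_apply_zero, hx, hx]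
      have := hsol 0
      rw [zero_sub, hφ1] at this
      have h' := congrArg (fun r : ℝ => (r : ℂ)) this
      simpa using h'
    | succ n =>
      rw [schrodingerPlus_apply_succ, hx, hx, hx]
      have := hsol (n + 1)
      rw [add_sub_cancel_right, add_assoc (n : ℤ) 1 1] at this
      have h' := congrArg (fun r : ℝ => (r : ℂ)) this
      simpa using h'
  have h0 : x 0 = 0 := by rw [hx0]; rfl
  rw [hx, Nat.cast_zero, hφ0] at h0
  simp at h0

/-- A vanishing lower-left entry makes `M 0 0` an eigenvalue, and `|M 0 0| < 1` rules out `l₁`. -/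
theorem hasEigenvector_iff_entries {M : Matrix (Fin 2) (Fin 2) ℝ} {l₁ l₂ : ℝ}
    (htr : l₁ + l₂ = M.trace) (hdet : l₁ * l₂ = M.det) (h2 : |l₂| < 1) (h1 : 1 < |l₁|) :
    Module.End.HasEigenvector (Matrix.toLin' M) l₂ ![1, 0] ↔ M 1 0 = 0 ∧ |M 0 0| < 1 := by
  have hiff : Module.End.HasEigenvector (Matrix.toLin' M) l₂ ![1, 0] ↔
      M 0 0 = l₂ ∧ M 1 0 = 0 := by
    rw [Module.End.hasEigenvector_iff, Module.End.mem_eigenspace_iff, Matrix.toLin'_apply]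
    simp [funext_iff, Fin.forall_fin_two]
  rw [hiff]
  refine ⟨fun h => ⟨h.2, by rwa [h.1]⟩, fun h => ⟨?_, h.1⟩⟩
  rw [Matrix.trace_fin_two] at htr
  rw [Matrix.det_fin_two, h.1, mul_zero, sub_zero] at hdet
  have hprod : (M 0 0 - l₁) * (M 0 0 - l₂) = 0 := by
    linear_combination hdet - M 0 0 * htr
  rcases mul_eq_zero.1 hprod with h0 | h0
  · rw [← sub_eq_zero.1 h0] at h1
    linarith [h.2]
  · exact sub_eq_zero.1 h0

theorem injective_of_isUnit {E : Type*} [NormedAddCommGroup E] [NormedSpace ℂ E]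
    {T : E →L[ℂ] E} (h : IsUnit T) : Function.Injective T := by
  obtain ⟨u, rfl⟩ := h
  refine Function.LeftInverse.injective (g := (↑u⁻¹ : E →L[ℂ] E)) fun x => ?_
  exact congrArg (fun T : E →L[ℂ] E => T x) u.inv_mul

end PeriodicSchrodinger

theorem proposition3p10 (K : ℕ) (hK : 0 < K) (v : ℤ → ℝ) (hv : Function.Periodic v (K : ℤ)) :
    (∀ (p : ℝ≥0∞) [Fact (1 ≤ p)],
      IsUnit (schrodinger p v (bounded_of_periodic hK hv)) ↔ 2 < |(monodromy v 0 K).trace|) ∧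
    (2 < |(monodromy v 0 K).trace| →
      ∃ l₁ l₂ : ℝ, (monodromy v 0 K).charpoly.roots = {l₁, l₂} ∧ |l₂| < 1 ∧ 1 < |l₁| ∧
        List.TFAE [
          ¬ Function.Injective (schrodingerPlus ∞ v (bounded_of_periodic hK hv)),
          ∀ (p : ℝ≥0∞) [Fact (1 ≤ p)],
            ¬ IsUnit (schrodingerPlus p v (bounded_of_periodic hK hv)),
          ∃ (p : ℝ≥0∞) (_ : Fact (1 ≤ p)),
            ¬ IsUnit (schrodingerPlus p v (bounded_of_periodic hK hv)),
          Module.End.HasEigenvector (Matrix.toLin' (monodromy v 0 K)) l₂ ![1, 0],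
          (monodromy v 0 K) 1 0 = 0 ∧ |(monodromy v 0 K) 0 0| < 1]) := by
  refine ⟨fun p _ => ⟨fun h => ?_, fun h => isUnit_schrodinger_of_hyperbolic hK hv h p⟩,
    fun ht => ?_⟩
  · by_contra! hle
    exact not_isUnit_schrodinger_of_abs_trace_le hK hv hle p h
  obtain ⟨l₁, l₂, htr, hdet, h2, h1⟩ := exists_hyperbolic_roots ht
  have hdet' : l₁ * l₂ = (monodromy v 0 K).det := by rw [hdet, det_monodromy]
  refine ⟨l₁, l₂, charpoly_roots_eq htr hdet', h2, h1, ?_⟩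
  have hnotinj := not_injective_schrodingerPlus_of_eigenvector hK hv
    (right_ne_zero_of_mul_eq_one hdet) h2
  tfae_have 1 → 3 := fun h => ⟨∞, inferInstance, fun hu => h (injective_of_isUnit hu)⟩
  tfae_have 2 → 3 := fun h => ⟨∞, inferInstance, h ∞⟩
  tfae_have 3 → 4 := by
    rintro ⟨p, _, hp⟩
    by_contra hnot
    exact hp (isUnit_schrodingerPlus_of_not_eigenvector hK hv htr hdet h2 h1 hnot p)
  tfae_have 4 ↔ 5 := hasEigenvector_iff_entries htr hdet' h2 h1
  tfae_have 4 → 1 := fun h => hnotinj h ∞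
  tfae_have 4 → 2 := fun h p _ hu => hnotinj h p (injective_of_isUnit hu)
  tfae_finish
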